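/- Let $n\ge 1$, let $\mathbb B$ be the open unit ball and $\mathbb S$ the unit sphere in $\mathbb R^n$, and let $h(\mathbb B)$ be the space of complex-valued harmonic functions on $\mathbb B$. Let $dx'$ be the rotation-invariant surface measure on $\mathbb S$, normalized so that $r^{n-1}\,dr\,dx'$ is the Lebesgue measure on $\mathbb B$ of total mass $1$. For $f\in h(\mathbb B)$, $\alpha>0$ and $0<p,q<\infty$ put $$M_q(f,r)=\Big(\int_{\mathbb S}|f(rx')|^q\,dx'\Big)^{1/q},\qquad \|f\|_{B^{p,q}_\alpha}=\Big(\int_0^1 M_q(f,r)^p(1-r^2)^{\alpha p-1}r^{n-1}\,dr\Big)^{1/p},$$ $$\|f\|_{F^{p,q}_\alpha}=\Big(\int_{\mathbb S}\Big(\int_0^1|f(rx')|^p(1-r)^{\alpha p-1}\,dr\Big)^{q/p}dx'\Big)^{1/q},$$ with values in $[0,\infty]$, and let $B^{p,q}_\alpha$ and $F^{p,q}_\alpha$ be the spaces of all $f\in h(\mathbb B)$ for which the respective quantity is finite. Let $0<p\le 1$, $p\le q<\infty$ and $\alpha>0$. Then $B^{p,p}_\alpha$ is continuously embedded into $F^{q,p}_\alpha$: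 one has $B^{p,p}_\alpha\subseteq F^{q,p}_\alpha$, and there is a constant $C>0$, depending only on $n$, $p$, $q$ and $\alpha$, such that $$\|f\|_{F^{q,p}_\alpha}\le C\,\|f\|_{B^{p,p}_\alpha}\qquad\text{for all } f\in h(\mathbb B).$$ -/

import Mathlib

open MeasureTheory Metric InnerProductSpace
open scoped ENNReal NNReal

namespace HarmonicBall

noncomputable section

/-- The Euclidean space `ℝⁿ`. -/
abbrev Rn (n : ℕ) : Type := EuclideanSpace ℝ (Fin n)

/-- The unit sphere of `ℝⁿ`. -/
abbrev S (n : ℕ) : Type := sphere (0 : Rn n) 1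

/-- The surface measure `dx'` on the unit sphere for which `dx = r ^ (n - 1) dr dx'` is Lebesgue
measure on the unit ball, normalized to have total mass one. -/
def surf (n : ℕ) : Measure (S n) :=
  (volume (ball (0 : Rn n) 1))⁻¹ • (volume : Measure (Rn n)).toSphere

/-- The space `h(𝔹)` of (complex-valued) harmonic functions in the open unit ball; values outside
the ball are irrelevant. -/
def harmonicSpace (n : ℕ) : Set (Rn n → ℂ) :=
  {f | HarmonicOnNhd f (ball (0 : Rn n) 1)}

/-- The integral mean `M_q(f, r)` over the sphere of radius `r`, for `0 < q ≤ ∞`. -/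
def integralMean {n : ℕ} (q : ℝ≥0∞) (f : Rn n → ℂ) (r : ℝ) : ℝ≥0∞ :=
  eLpNorm (fun x' : S n => f (r • (x' : Rn n))) q (surf n)

/-- The mixed (quasi-)norm of the Bergman type space `B^{p,q}_α`, with values in `[0, ∞]`:
`(∫₀¹ M_q(f, r)^p (1 - r²)^{α p - 1} r^{n-1} dr)^{1/p}`. -/
def normB {n : ℕ} (p : ℝ) (q : ℝ≥0∞) (α : ℝ) (f : Rn n → ℂ) : ℝ≥0∞ :=
  (∫⁻ r in Set.Ioo (0 : ℝ) 1,
    integralMean q f r ^ p * ENNReal.ofReal ((1 - r ^ 2) ^ (α * p - 1) * r ^ (n - 1))) ^ (1 / p)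

/-- The Bergman type mixed norm space `B^{p,q}_α`. -/
def spaceB (n : ℕ) (p : ℝ) (q : ℝ≥0∞) (α : ℝ) : Set (Rn n → ℂ) :=
  {f | f ∈ harmonicSpace n ∧ normB p q α f < ∞}

/-- The (quasi-)norm of the harmonic Triebel–Lizorkin space `F^{p,q}_α`, with values in `[0, ∞]`:
`(∫_𝕊 (∫₀¹ |f(r x')|^p (1 - r)^{α p - 1} dr)^{q/p} dx')^{1/q}`. -/
def normF {n : ℕ} (p q α : ℝ) (f : Rn n → ℂ) : ℝ≥0∞ :=
  (∫⁻ x' : S n, (∫⁻ r in Set.Ioo (0 : ℝ) 1,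
    ‖f (r • (x' : Rn n))‖ₑ ^ p * ENNReal.ofReal ((1 - r) ^ (α * p - 1))) ^ (q / p) ∂(surf n))
      ^ (1 / q)

/-- The harmonic Triebel–Lizorkin space `F^{p,q}_α`. -/
def spaceF (n : ℕ) (p q α : ℝ) : Set (Rn n → ℂ) :=
  {f | f ∈ harmonicSpace n ∧ normF p q α f < ∞}

end

end HarmonicBall

/-! Put `g = |f|^p`, `s = q/p ≥ 1`, `β = αp`. Taking `p`-th powers, the claim becomes an estimate of
`∫_S (∫ g^s (1-r)^(βs-1) dr)^(1/s)` by `∫_B g (1-|w|)^(β-1)`. On one radius let `M` bound `g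
(1-r)^β` and let `D = ∫ g (1-r)^(β-1) dr`. The inner integral is at most `M^(s-1) D ≤ (M+D)^s`, so
its root is at most `M + D` (`rpow_lintegral_le_add`).

It remains to integrate such an `M` over the sphere. Although `p ≤ 1`, `g` is dominated by its means
over balls (`exists_enorm_rpow_mul_ofReal_pow_le`, resting on a weighted mean value property). Hence
a multiple of the integral of local means of `g` along the radius serves as `M`
(`exists_mul_ofReal_rpow_le_radialIntegral`), and Tonelli returns the integral of these local means
to the weighted integral of `g` (`exists_lintegral_localMean_le`). -/

namespace HarmonicBall

/-! ### Weighted mean value property of harmonic functions -/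

section MeanValue

open Laplacian

/-- The derivative of `u ↦ (max 0 u) ^ 2`. -/
theorem hasDerivAt_max_zero_sq (u : ℝ) :
    HasDerivAt (fun u : ℝ => (max 0 u) ^ 2) (2 * max 0 u) u := by
  rcases lt_trichotomy u 0 with h | rfl | h
  · rw [max_eq_left h.le, mul_zero]
    refine (hasDerivAt_const u (0 : ℝ)).congr_of_eventuallyEq ?_
    filter_upwards [eventually_lt_nhds h] with v hv
    simp [max_eq_left hv.le]
  · rw [max_self, mul_zero, hasDerivAt_iff_isLittleO]
    simp only [max_self, sub_zero, smul_zero, ne_eq, OfNat.ofNat_ne_zero, not_false_eq_true,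
      zero_pow]
    refine Asymptotics.IsBigO.trans_isLittleO (g := fun v : ℝ => v ^ 2) ?_
      (Asymptotics.isLittleO_pow_id (by norm_num))
    refine Asymptotics.IsBigO.of_norm_le fun v => ?_
    rcases le_total v 0 with h | h <;> simp [h, sq_nonneg]
  · rw [max_eq_right h.le]
    refine (by simpa using hasDerivAt_pow 2 u : HasDerivAt (fun v : ℝ => v ^ 2) (2 * u) u)
      |>.congr_of_eventuallyEq ?_
    filter_upwards [eventually_gt_nhds h] with v hv
    simp [max_eq_right hv.le]

variable {E : Type*} [NormedAddCommGroup E]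

/-- The radial weight `(1 - ‖y‖²)₊`. -/
noncomputable def radialWeight (y : E) : ℝ := max 0 (1 - ‖y‖ ^ 2)

theorem continuous_radialWeight : Continuous (radialWeight : E → ℝ) := by
  unfold radialWeight; fun_prop

theorem radialWeight_nonneg (y : E) : 0 ≤ radialWeight y := le_max_left _ _

theorem radialWeight_le_one (y : E) : radialWeight y ≤ 1 :=
  max_le zero_le_one (by nlinarith [sq_nonneg ‖y‖])

theorem radialWeight_eq_zero {y : E} (hy : y ∉ ball (0 : E) 1) : radialWeight y = 0 := by
  have : 1 ≤ ‖y‖ := by simpa using hy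
  exact max_eq_left (by nlinarith)

theorem radialWeight_pos {y : E} (hy : y ∈ ball (0 : E) 1) : 0 < radialWeight y := by
  have : ‖y‖ < 1 := by simpa using hy
  exact lt_max_of_lt_right (by nlinarith [norm_nonneg y])

variable [InnerProductSpace ℝ E]

/-- Squaring removes the kink of the weight, and the gradient is `-4 radialWeight y • y`: the
weighted radial field is a gradient, ready for integration by parts. -/
theorem hasFDerivAt_radialWeight_sq (y : E) :
    HasFDerivAt (fun y : E => radialWeight y ^ 2) ((-4 * radialWeight y) • innerSL ℝ y) y := by
  have h1 : HasFDerivAt (fun y : E => 1 - ‖y‖ ^ 2) (-(2 • innerSL ℝ y)) y :=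
    (hasStrictFDerivAt_norm_sq y).hasFDerivAt.const_sub 1
  refine ((hasDerivAt_max_zero_sq _).comp_hasFDerivAt y h1).congr_fderiv ?_
  ext v
  simp [radialWeight]
  ring

variable [FiniteDimensional ℝ E]

theorem hasCompactSupport_radialWeight : HasCompactSupport (radialWeight : E → ℝ) :=
  HasCompactSupport.intro (isCompact_closedBall (0 : E) 1) fun _ hy =>
    radialWeight_eq_zero fun h => hy (ball_subset_closedBall h)

variable [MeasurableSpace E] [BorelSpace E]

theorem integrable_radialWeight : Integrable (radialWeight : E → ℝ) :=
  continuous_radialWeight.integrable_of_hasCompactSupport hasCompactSupport_radialWeight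

theorem integral_radialWeight_pos : 0 < ∫ y : E, radialWeight y := by
  refine (continuous_radialWeight.integral_pos_of_hasCompactSupport_nonneg_nonzero
    hasCompactSupport_radialWeight radialWeight_nonneg (x := 0) ?_)
  exact (radialWeight_pos (by simp)).ne'

theorem integrable_radialWeight_smul {F : Type*} [NormedAddCommGroup F] [NormedSpace ℝ F]
    {h : E → F} (hh : Continuous h) : Integrable (fun y : E => radialWeight y • h y) :=
  (continuous_radialWeight.smul hh).integrable_of_hasCompactSupport
    hasCompactSupport_radialWeight.smul_right

/-- Integration by parts: the radial derivative of a harmonic function has vanishing weighted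
mean. -/
theorem integral_radialWeight_smul_fderiv_eq_zero {F : E → ℂ} (hF : ContDiff ℝ 2 F) {z : E}
    {R s : ℝ} (hΔ : ∀ x ∈ ball z R, (Δ F) x = 0) (hs0 : 0 ≤ s) (hsR : s ≤ R) :
    ∫ y : E, radialWeight y • fderiv ℝ F (z + s • y) y = 0 := by
  set b := stdOrthonormalBasis ℝ E
  have hF1 : ContDiff ℝ 1 (fderiv ℝ F) := hF.fderiv_right (by norm_num)
  have hcont2 : Continuous (fderiv ℝ (fderiv ℝ F)) := hF1.continuous_fderiv (by norm_num)
  have hg (v y : E) : HasFDerivAt (fun y : E => fderiv ℝ F (z + s • y) v)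
      (((ContinuousLinearMap.apply ℝ ℂ v).comp (fderiv ℝ (fderiv ℝ F) (z + s • y))).comp
        (s • ContinuousLinearMap.id ℝ E)) y := by
    have h1 : HasFDerivAt (fun y : E => z + s • y) (s • ContinuousLinearMap.id ℝ E) y :=
      ((hasFDerivAt_id y).const_smul s).const_add z
    have h2 := ((hF1.differentiable (by norm_num)) (z + s • y)).hasFDerivAt
    exact ((ContinuousLinearMap.apply ℝ ℂ v).hasFDerivAt.comp y (h2.comp y h1))
  have hg' (v y : E) : fderiv ℝ (fun y : E => fderiv ℝ F (z + s • y) v) y v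
      = s • fderiv ℝ (fderiv ℝ F) (z + s • y) v v := by
    rw [(hg v y).fderiv]; simp
  have hψ' (v y : E) : fderiv ℝ (fun y : E => radialWeight y ^ 2) y v
      = radialWeight y * (-4 * inner ℝ y v) := by
    rw [(hasFDerivAt_radialWeight_sq y).fderiv]; simp; ring
  have hcg (v : E) : Continuous (fun y : E => fderiv ℝ F (z + s • y) v) := by
    have := hF1.continuous
    fun_prop
  have hcg2 (v : E) : Continuous (fun y : E => fderiv ℝ (fderiv ℝ F) (z + s • y) v v) := by
    fun_prop
  -- Summed over an orthonormal basis, the left side produces the Laplacian and the right side the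
  -- radial derivative.
  have parts (v : E) : ∫ y : E, radialWeight y ^ 2 • (s • fderiv ℝ (fderiv ℝ F) (z + s • y) v v)
      = 4 * ∫ y : E, radialWeight y • (inner ℝ y v • fderiv ℝ F (z + s • y) v) := by
    have := integral_smul_fderiv_eq_neg_fderiv_smul_of_integrable (𝕜 := ℝ)
      (μ := (volume : Measure E)) (f := fun y : E => radialWeight y ^ 2)
      (g := fun y : E => fderiv ℝ F (z + s • y) v) (v := v) ?_ ?_ ?_
      (fun y _ => (hasFDerivAt_radialWeight_sq y).differentiableAt)
      (fun y _ => (hg v y).differentiableAt)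
    · simp only [hg', hψ'] at this
      rw [this, ← integral_const_mul, ← integral_neg]
      congr 1 with y
      simp only [Complex.real_smul]
      push_cast
      ring
    · simp only [hψ', mul_smul]
      exact integrable_radialWeight_smul (by fun_prop)
    · simp only [hg', pow_two, mul_smul]
      exact integrable_radialWeight_smul (continuous_radialWeight.smul (by fun_prop))
    · simp only [pow_two, mul_smul]
      exact integrable_radialWeight_smul (continuous_radialWeight.smul (by fun_prop))
  have key : (4 : ℂ) * ∫ y : E, radialWeight y • fderiv ℝ F (z + s • y) y = 0 := by
    calc (4 : ℂ) * ∫ y : E, radialWeight y • fderiv ℝ F (z + s • y) y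
        = 4 * ∫ y : E, ∑ i, radialWeight y •
            (inner ℝ y (b i) • fderiv ℝ F (z + s • y) (b i)) := by
          congr 2 with y
          rw [← Finset.smul_sum]
          congr 1
          conv_lhs => rw [← b.sum_repr' y]
          rw [map_sum]
          simp only [map_smul]
          refine Finset.sum_congr rfl fun i _ => ?_
          rw [real_inner_comm, b.sum_repr' y]
      _ = ∑ i, 4 * ∫ y : E, radialWeight y •
            (inner ℝ y (b i) • fderiv ℝ F (z + s • y) (b i)) := by
          rw [integral_finsetSum _ fun i _ => integrable_radialWeight_smul
            (by have := hcg (b i); fun_prop), Finset.mul_sum]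
      _ = ∑ i, ∫ y : E, radialWeight y ^ 2 •
            (s • fderiv ℝ (fderiv ℝ F) (z + s • y) (b i) (b i)) := by
          simp only [parts]
      _ = ∫ y : E, radialWeight y ^ 2 • (s • (Δ F) (z + s • y)) := by
          rw [← integral_finsetSum]
          · congr 1 with y
            rw [← Finset.smul_sum, ← Finset.smul_sum,
              laplacian_eq_iteratedFDeriv_stdOrthonormalBasis]
            simp [iteratedFDeriv_two_apply, b]
          · intro i _
            simp only [pow_two, mul_smul]
            exact integrable_radialWeight_smul (continuous_radialWeight.smul
              (by have := hcg2 (b i); fun_prop))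
      _ = 0 := by
          refine integral_eq_zero_of_ae (.of_forall fun y => ?_)
          by_cases hy : y ∈ ball (0 : E) 1
          · by_cases h0 : s = 0
            · simp [h0]
            · have hs : 0 < s := lt_of_le_of_ne hs0 (Ne.symm h0)
              have hy' : ‖y‖ < 1 := by simpa using hy
              have : z + s • y ∈ ball z R := by
                simp only [mem_ball, dist_self_add_left, norm_smul, Real.norm_eq_abs,
                  abs_of_pos hs]
                nlinarith
              simp [hΔ _ this]
          · simp [radialWeight_eq_zero hy]
  simpa using key

/-- The weighted mean value property. -/
theorem integral_radialWeight_smul_eq {F : E → ℂ} (hF : ContDiff ℝ 2 F) {z : E} {R : ℝ}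
    (hR : 0 ≤ R) (hΔ : ∀ x ∈ ball z R, (Δ F) x = 0) :
    ∫ y : E, radialWeight y • F (z + R • y) = (∫ y : E, radialWeight y) • F z := by
  -- The weighted mean is constant in the dilation `s` on `[0, R]`; compare `s = R` with `s = 0`.
  set G : ℝ → ℂ := fun s => ∫ y : E, radialWeight y • F (z + s • y)
  have hF1 : Continuous (fderiv ℝ F) := hF.continuous_fderiv (by norm_num)
  have hFc := hF.continuous
  have hG (s : ℝ) : HasDerivAt G (∫ y : E, radialWeight y • fderiv ℝ F (z + s • y) y) s := by
    obtain ⟨C, hC⟩ := (isCompact_closedBall z (|s| + 1)).exists_bound_of_continuousOn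
      hF1.continuousOn
    refine (hasDerivAt_integral_of_dominated_loc_of_deriv_le (ball_mem_nhds s one_pos)
      (bound := fun y : E => radialWeight y * C)
      (F := fun s y => radialWeight y • F (z + s • y))
      (F' := fun s y => radialWeight y • fderiv ℝ F (z + s • y) y) ?_ ?_ ?_ ?_ ?_ ?_).2
    · exact .of_forall fun t =>
        (integrable_radialWeight_smul (by fun_prop)).aestronglyMeasurable
    · exact integrable_radialWeight_smul (by fun_prop)
    · exact (integrable_radialWeight_smul (by fun_prop)).aestronglyMeasurable
    · refine .of_forall fun y t ht => ?_
      rw [norm_smul, Real.norm_of_nonneg (radialWeight_nonneg y)]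
      by_cases hy : y ∈ ball (0 : E) 1
      · gcongr
        · exact radialWeight_nonneg y
        have hy' : ‖y‖ < 1 := by simpa using hy
        have ht' : |t| ≤ |s| + 1 := by
          have h1 : |t - s| < 1 := by simpa [Real.dist_eq] using ht
          have h2 := abs_sub_abs_le_abs_sub t s
          linarith
        have hmem : z + t • y ∈ closedBall z (|s| + 1) := by
          simp only [mem_closedBall, dist_self_add_left, norm_smul, Real.norm_eq_abs]
          nlinarith [abs_nonneg t, norm_nonneg y]
        have h0 : 0 ≤ C := (norm_nonneg _).trans (hC _ hmem)
        calc ‖fderiv ℝ F (z + t • y) y‖ ≤ ‖fderiv ℝ F (z + t • y)‖ * ‖y‖ :=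
              ContinuousLinearMap.le_opNorm _ _
          _ ≤ C * 1 := by gcongr; exact hC _ hmem
          _ = C := mul_one C
      · simp [radialWeight_eq_zero hy]
    · exact integrable_radialWeight.mul_const C
    · refine .of_forall fun y t _ => ?_
      have h1 : HasDerivAt (fun t : ℝ => z + t • y) y t := by
        simpa using ((hasDerivAt_id t).smul_const y).const_add z
      exact (((hF.differentiable (by norm_num)) (z + t • y)).hasFDerivAt.comp_hasDerivAt t
        h1).const_smul (radialWeight y)
  have hconst := constant_of_has_deriv_right_zero (f := G) (a := 0) (b := R)
    (fun s _ => (hG s).continuousAt.continuousWithinAt) (fun s hs => by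
      have := (hG s).hasDerivWithinAt (s := Set.Ici s)
      rwa [integral_radialWeight_smul_fderiv_eq_zero hF hΔ hs.1 hs.2.le] at this)
    R ⟨hR, le_rfl⟩
  simp only [G, zero_smul, add_zero] at hconst
  rw [hconst, integral_smul_const]

end MeanValue

/-! ### Domination of `|f|^p` by means over balls -/

section SubMeanValue

open Laplacian

variable {E : Type*} [NormedAddCommGroup E] [InnerProductSpace ℝ E] [FiniteDimensional ℝ E]

/-- A harmonic function on a ball agrees on a smaller concentric ball with a globally `C²`
function. -/
theorem exists_contDiff_eqOn_ball {f : E → ℂ} {z : E} {R R' : ℝ} (hR : 0 < R) (hRR' : R < R')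
    (hf : HarmonicOnNhd f (ball z R')) :
    ∃ F : E → ℂ, ContDiff ℝ 2 F ∧ (∀ x ∈ closedBall z R, F x = f x) ∧
      ∀ x ∈ ball z R, (Δ F) x = 0 := by
  -- The outer radius lies strictly below `R'`, so `χ • f` vanishes near every point where `f` is
  -- not known to be smooth.
  let χ : ContDiffBump z := ⟨R, (R + R') / 2, hR, by linarith⟩
  have hone (x : E) (hx : x ∈ closedBall z R) : χ x • f x = f x := by
    rw [χ.one_of_mem_closedBall hx, one_smul]
  refine ⟨fun x => χ x • f x, contDiff_iff_contDiffAt.2 fun x => ?_, hone, fun x hx => ?_⟩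
  · by_cases hx : x ∈ ball z R'
    · exact χ.contDiff.contDiffAt.smul (hf x hx).1
    · refine (contDiffAt_const (c := (0 : ℂ))).congr_of_eventuallyEq ?_
      have hx' : x ∈ (closedBall z ((R + R') / 2))ᶜ := fun h => hx
        (closedBall_subset_ball (by linarith) h)
      filter_upwards [isClosed_closedBall.isOpen_compl.mem_nhds hx'] with y hy
      have : χ y = 0 := χ.zero_of_le_dist (not_le.1 fun h => hy (mem_closedBall.2 h)).le
      simp [this]
  · have heq : (fun x => χ x • f x) =ᶠ[nhds x] f := by
      filter_upwards [isOpen_ball.mem_nhds hx] with y hy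
      exact hone y (ball_subset_closedBall hy)
    rw [(laplacian_congr_nhds heq).eq_of_nhds]
    exact (hf x (ball_subset_ball hRR'.le hx)).2.eq_of_nhds

variable [MeasurableSpace E] [BorelSpace E]

/-- Change of variables between a ball and the unit ball. -/
theorem ofReal_pow_mul_lintegral_unitBall (g : E → ℝ≥0∞) (z : E) {R : ℝ} (hR : 0 < R) :
    ENNReal.ofReal (R ^ Module.finrank ℝ E) * ∫⁻ y in ball (0 : E) 1, g (z + R • y)
      = ∫⁻ w in ball z R, g w := by
  have hind : (fun y => (ball (0 : E) 1).indicator (fun y => g (z + R • y)) y)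
      = fun y => (ball z R).indicator g (z + R • y) := by
    ext y
    have : z + R • y ∈ ball z R ↔ y ∈ ball (0 : E) 1 := by
      simp [norm_smul, abs_of_pos hR, hR]
    by_cases hy : y ∈ ball (0 : E) 1
    · rw [Set.indicator_of_mem hy, Set.indicator_of_mem (this.2 hy)]
    · rw [Set.indicator_of_notMem hy, Set.indicator_of_notMem (mt this.1 hy)]
  have hmap := lintegral_map_equiv (μ := (volume : Measure E))
    (fun y => (ball z R).indicator g (z + y))
    (Homeomorph.smulOfNeZero R hR.ne' : E ≃ₜ E).toMeasurableEquiv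
  rw [← lintegral_indicator measurableSet_ball, ← lintegral_indicator measurableSet_ball, hind]
  simp only [Homeomorph.toMeasurableEquiv_coe, Homeomorph.smulOfNeZero_apply] at hmap
  rw [← hmap]
  change _ * lintegral (Measure.map (R • ·) volume) _ = _
  rw [Measure.map_addHaar_smul _ hR.ne', lintegral_smul_measure, lintegral_add_left_eq_self,
    smul_eq_mul, ← mul_assoc, ← ENNReal.ofReal_mul (by positivity), abs_of_pos (by positivity),
    mul_inv_cancel₀ (by positivity), ENNReal.ofReal_one, one_mul]

/-- Harmonic functions are dominated by their means over balls. -/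
theorem enorm_mul_ofReal_pow_le {f : E → ℂ} {z : E} {R R' : ℝ} (hR : 0 < R) (hRR' : R < R')
    (hf : HarmonicOnNhd f (ball z R')) :
    ENNReal.ofReal (∫ y : E, radialWeight y) *
      (‖f z‖ₑ * ENNReal.ofReal (R ^ Module.finrank ℝ E)) ≤ ∫⁻ w in ball z R, ‖f w‖ₑ := by
  obtain ⟨F, hF, hFf, hΔ⟩ := exists_contDiff_eqOn_ball hR hRR' hf
  have hmv := integral_radialWeight_smul_eq hF hR.le hΔ
  rw [← ofReal_pow_mul_lintegral_unitBall _ z hR, ← mul_assoc,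
    mul_comm (ENNReal.ofReal (R ^ _))]
  refine mul_le_mul_left ?_ _
  calc ENNReal.ofReal (∫ y : E, radialWeight y) * ‖f z‖ₑ
      = ‖(∫ y : E, radialWeight y) • F z‖ₑ := by
        rw [enorm_smul, hFf z (mem_closedBall_self hR.le), Real.enorm_eq_ofReal
          integral_radialWeight_pos.le]
    _ ≤ ∫⁻ y : E, ‖radialWeight y • F (z + R • y)‖ₑ := by
        rw [← hmv]; exact enorm_integral_le_lintegral_enorm _
    _ ≤ ∫⁻ y : E, (ball (0 : E) 1).indicator (fun y => ‖f (z + R • y)‖ₑ) y := by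
        refine lintegral_mono fun y => ?_
        by_cases hy : y ∈ ball (0 : E) 1
        · have hy' : ‖y‖ < 1 := by simpa using hy
          have hmem : z + R • y ∈ closedBall z R := by
            simp only [mem_closedBall, dist_self_add_left, norm_smul, Real.norm_eq_abs,
              abs_of_pos hR]
            nlinarith
          rw [Set.indicator_of_mem hy, enorm_smul, hFf _ hmem]
          refine mul_le_of_le_one_left' ?_
          rw [Real.enorm_eq_ofReal (radialWeight_nonneg y)]
          exact ENNReal.ofReal_le_one.2 (radialWeight_le_one y)
        · simp [radialWeight_eq_zero hy]
    _ = _ := lintegral_indicator measurableSet_ball _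

/-- The Hardy–Littlewood inequality: `|f| ^ p` is dominated by its means over balls even when
`p ≤ 1`. -/
theorem exists_enorm_rpow_mul_ofReal_pow_le {p : ℝ} (hp : 0 < p) (hp1 : p ≤ 1) :
    ∃ C : ℝ≥0, ∀ (f : E → ℂ) (z : E) (R R' : ℝ), 0 < R → R < R' →
      HarmonicOnNhd f (ball z R') →
      ‖f z‖ₑ ^ p * ENNReal.ofReal (R ^ Module.finrank ℝ E) ≤ C * ∫⁻ w in ball z R, ‖f w‖ₑ ^ p := by
  set n := Module.finrank ℝ E
  set c : ℝ := ∫ y : E, radialWeight y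
  have hc : 0 < c := integral_radialWeight_pos
  -- The factors come from the weighted mean value, from `R - dist v z = 2ρ`, and from the bound
  -- `hbd` raised to the power `1 - p`.
  refine ⟨Real.toNNReal (c⁻¹ * 2 ^ n * (2 ^ n) ^ ((1 - p) / p)), fun f z R R' hR hRR' hf => ?_⟩
  have hcont : ContinuousOn f (closedBall z R) :=
    hf.continuousOn.mono (closedBall_subset_ball hRR')
  -- At a maximizer `v` of this function, `|f|^p ≤ 2^n |f v|^p` on the ball about `v` of half the
  -- remaining radius. Writing `|f| = |f|^(1-p) |f|^p` there, the mean value estimate at `v` allows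
  -- `|f v|^(1-p)` to be cancelled.
  have hK : ContinuousOn (fun w => ‖f w‖ ^ p * (R - dist w z) ^ n) (closedBall z R) := by
    refine ContinuousOn.mul (hcont.norm.rpow_const fun _ _ => Or.inr hp.le) ?_
    fun_prop
  obtain ⟨v, hv, hmax⟩ := (isCompact_closedBall z R).exists_isMaxOn
    ⟨z, mem_closedBall_self hR.le⟩ hK
  have hz : ‖f z‖ ^ p * R ^ n ≤ ‖f v‖ ^ p * (R - dist v z) ^ n := by
    simpa using hmax (mem_closedBall_self hR.le)
  have hlhs : ‖f z‖ₑ ^ p * ENNReal.ofReal (R ^ n) = ENNReal.ofReal (‖f z‖ ^ p * R ^ n) := by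
    rw [ENNReal.ofReal_mul (by positivity), ← ENNReal.ofReal_rpow_of_nonneg (norm_nonneg _) hp.le,
      ofReal_norm]
  rw [hlhs]
  rcases eq_or_ne (f v) 0 with h0 | h0
  · rw [h0, norm_zero, Real.zero_rpow hp.ne', zero_mul] at hz
    rw [ENNReal.ofReal_of_nonpos hz]
    exact zero_le
  -- On the boundary the maximum is `0`, provided `n ≠ 0` (as `0 ^ 0 = 1`); `v ≠ z` ensures this.
  rcases eq_or_lt_of_le (mem_closedBall.1 hv) with hd | hd
  · have hvz : v ≠ z := dist_pos.1 (hd ▸ hR)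
    have : Nontrivial E := ⟨v, z, hvz⟩
    rw [hd, sub_self, zero_pow Module.finrank_pos.ne', mul_zero] at hz
    rw [ENNReal.ofReal_of_nonpos hz]
    exact zero_le
  set ρ : ℝ := (R - dist v z) / 2
  have hρ : 0 < ρ := by simp only [ρ]; linarith
  have hsub : ball v ρ ⊆ ball z R := ball_subset_ball' (by simp only [ρ]; linarith)
  have hbd : ∀ w ∈ ball v ρ, ‖f w‖ ≤ (2 ^ n) ^ (1 / p) * ‖f v‖ := by
    intro w hw
    have h1 := hmax (ball_subset_closedBall (hsub hw))
    have h2 : ρ ≤ R - dist w z := by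
      have := dist_triangle w v z
      have h3 : dist w v < ρ := hw
      simp only [ρ] at h3 ⊢
      linarith
    have h4 : ‖f w‖ ^ p * ρ ^ n ≤ (2 ^ n * ‖f v‖ ^ p) * ρ ^ n := by
      calc ‖f w‖ ^ p * ρ ^ n ≤ ‖f w‖ ^ p * (R - dist w z) ^ n := by gcongr
        _ ≤ ‖f v‖ ^ p * (R - dist v z) ^ n := h1
        _ = (2 ^ n * ‖f v‖ ^ p) * ρ ^ n := by
          rw [show R - dist v z = 2 * ρ by simp only [ρ]; ring, mul_pow]; ring
    have h5 := le_of_mul_le_mul_right h4 (by positivity)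
    rw [← Real.rpow_le_rpow_iff (norm_nonneg _) (by positivity) hp,
      Real.mul_rpow (by positivity) (norm_nonneg _), ← Real.rpow_mul (by positivity),
      one_div_mul_cancel hp.ne', Real.rpow_one]
    exact h5
  have hmean := enorm_mul_ofReal_pow_le (z := v) (R := ρ) (R' := 2 * ρ) hρ (by linarith)
    (hf.mono (ball_subset_ball' (by simp only [ρ]; linarith)))
  set I := ∫⁻ w in ball z R, ‖f w‖ₑ ^ p
  set D : ℝ := ((2 ^ n) ^ (1 / p) * ‖f v‖) ^ (1 - p)
  have hint : ∫⁻ w in ball v ρ, ‖f w‖ₑ ≤ ENNReal.ofReal D * I := by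
    calc ∫⁻ w in ball v ρ, ‖f w‖ₑ ≤ ∫⁻ w in ball v ρ, ENNReal.ofReal D * ‖f w‖ₑ ^ p := by
          refine setLIntegral_mono' measurableSet_ball fun w hw => ?_
          calc ‖f w‖ₑ = ‖f w‖ₑ ^ (1 - p) * ‖f w‖ₑ ^ p := by
                rw [← ENNReal.rpow_add_of_nonneg _ _ (by linarith) hp.le]; simp
            _ ≤ ENNReal.ofReal D * ‖f w‖ₑ ^ p := by
                gcongr
                rw [← ofReal_norm, ENNReal.ofReal_rpow_of_nonneg (norm_nonneg _) (by linarith)]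
                exact ENNReal.ofReal_le_ofReal
                  (Real.rpow_le_rpow (norm_nonneg _) (hbd w hw) (by linarith))
      _ = ENNReal.ofReal D * ∫⁻ w in ball v ρ, ‖f w‖ₑ ^ p :=
          lintegral_const_mul' _ _ ENNReal.ofReal_ne_top
      _ ≤ ENNReal.ofReal D * I := by gcongr; exact lintegral_mono_set hsub
  rcases eq_or_ne I ∞ with hI | hI
  · rw [hI, ENNReal.mul_top]
    · exact le_top
    · simp only [ne_eq, ENNReal.coe_eq_zero, Real.toNNReal_eq_zero, not_le]
      positivity
  have hfin := hmean.trans hint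
  rw [← ENNReal.ofReal_toReal hI] at hfin ⊢
  rw [← ofReal_norm, ← ENNReal.ofReal_mul (norm_nonneg _), ← ENNReal.ofReal_mul hc.le,
    ← ENNReal.ofReal_mul (by positivity), ENNReal.ofReal_le_ofReal_iff (by positivity)] at hfin
  rw [← ENNReal.ofReal, ← ENNReal.ofReal_mul (by positivity)]
  refine ENNReal.ofReal_le_ofReal (hz.trans ?_)
  have hfv : 0 < ‖f v‖ := norm_pos_iff.2 h0
  have hD : D = (2 ^ n) ^ ((1 - p) / p) * ‖f v‖ ^ (1 - p) := by
    simp only [D]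
    rw [Real.mul_rpow (by positivity) hfv.le, ← Real.rpow_mul (by positivity)]
    congr 2; ring
  have hsplit : ‖f v‖ = ‖f v‖ ^ p * ‖f v‖ ^ (1 - p) := by
    rw [← Real.rpow_add hfv]; simp
  have hkey : c * (‖f v‖ ^ p * ρ ^ n) ≤ (2 ^ n) ^ ((1 - p) / p) * I.toReal := by
    refine le_of_mul_le_mul_right ?_ (Real.rpow_pos_of_pos hfv (1 - p))
    calc c * (‖f v‖ ^ p * ρ ^ n) * ‖f v‖ ^ (1 - p)
        = c * ((‖f v‖ ^ p * ‖f v‖ ^ (1 - p)) * ρ ^ n) := by ring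
      _ ≤ D * I.toReal := by rw [← hsplit]; exact hfin
      _ = _ := by rw [hD]; ring
  calc ‖f v‖ ^ p * (R - dist v z) ^ n = c⁻¹ * 2 ^ n * (c * (‖f v‖ ^ p * ρ ^ n)) := by
        rw [show R - dist v z = 2 * ρ by simp only [ρ]; ring, mul_pow]
        field_simp
    _ ≤ c⁻¹ * 2 ^ n * ((2 ^ n) ^ ((1 - p) / p) * I.toReal) := by gcongr
    _ = _ := by ring

end SubMeanValue

/-! ### Polar coordinates -/

section PolarCoordinates

/-- Polar coordinates in the unit ball. -/
theorem lintegral_toSphere_lintegral_Ioo {E : Type*} [NormedAddCommGroup E] [NormedSpace ℝ E]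
    [FiniteDimensional ℝ E] [Nontrivial E] [MeasurableSpace E] [BorelSpace E] (μ : Measure E)
    [μ.IsAddHaarMeasure] {G : E → ℝ≥0∞} (hG : Measurable G) :
    ∫⁻ x' : sphere (0 : E) 1, (∫⁻ r in Set.Ioo (0 : ℝ) 1, G (r • (x' : E)) *
      ENNReal.ofReal (r ^ (Module.finrank ℝ E - 1))) ∂μ.toSphere
      = ∫⁻ z in ball (0 : E) 1, G z ∂μ := by
  set H : E → ℝ≥0∞ := (ball (0 : E) 1).indicator G
  have hH : Measurable H := hG.indicator measurableSet_ball
  have hsmul (x' : sphere (0 : E) 1) (r : ℝ) (hr : 0 < r) : H (r • (x' : E)) *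
      ENNReal.ofReal (r ^ (Module.finrank ℝ E - 1)) = (Set.Iio (1 : ℝ)).indicator
        (fun r => G (r • (x' : E)) * ENNReal.ofReal (r ^ (Module.finrank ℝ E - 1))) r := by
    simp only [H, Set.indicator, mem_ball_zero_iff, norm_smul, norm_eq_of_mem_sphere,
      Real.norm_eq_abs, abs_of_pos hr, mul_one, Set.mem_Iio, ite_mul, zero_mul]
  have hpolar := μ.measurePreserving_homeomorphUnitSphereProd.symm
    (Homeomorph.toMeasurableEquiv (homeomorphUnitSphereProd E)) |>.lintegral_comp
    (hH.comp measurable_subtype_coe)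
  have hmeas : Measurable fun p : sphere (0 : E) 1 × Set.Ioi (0 : ℝ) =>
      H ((p.2 : ℝ) • (p.1 : E)) := hH.comp (by fun_prop)
  simp only [Homeomorph.toMeasurableEquiv_symm_coe, Function.comp_apply,
    homeomorphUnitSphereProd_symm_apply_coe] at hpolar
  rw [lintegral_prod _ hmeas.aemeasurable,
    lintegral_subtype_comap (measurableSet_singleton _).compl, restrict_compl_singleton] at hpolar
  dsimp only at hpolar
  rw [← lintegral_indicator measurableSet_ball, ← hpolar]
  refine lintegral_congr fun x' => ?_
  have hm : Measurable fun y : Set.Ioi (0 : ℝ) => H ((y : ℝ) • (x' : E)) :=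
    hH.comp (by fun_prop)
  rw [Measure.volumeIoiPow, lintegral_withDensity_eq_lintegral_mul _ (by fun_prop) hm]
  simp only [Pi.mul_apply, mul_comm (ENNReal.ofReal _)]
  rw [lintegral_subtype_comap measurableSet_Ioi (fun r : ℝ => H (r • (x' : E)) *
      ENNReal.ofReal (r ^ (Module.finrank ℝ E - 1))),
    setLIntegral_congr_fun measurableSet_Ioi fun r hr => hsmul x' r hr,
    setLIntegral_indicator measurableSet_Iio, Set.Iio_inter_Ioi]

end PolarCoordinates

/-! ### Local means and their radial integrals -/

theorem rpow_le_two_rpow_abs_mul {a b : ℝ} (γ : ℝ) (ha : 0 < a) (hb : 0 < b) (hab : a ≤ 2 * b)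
    (hba : b ≤ 2 * a) : a ^ γ ≤ 2 ^ |γ| * b ^ γ := by
  rcases le_total 0 γ with h | h
  · rw [abs_of_nonneg h, ← Real.mul_rpow two_pos.le hb.le]
    exact Real.rpow_le_rpow ha.le hab h
  · rw [abs_of_nonpos h]
    calc a ^ γ ≤ (2⁻¹ * b) ^ γ := Real.rpow_le_rpow_of_nonpos (by positivity) (by linarith) h
      _ = _ := by rw [Real.mul_rpow (by positivity) hb.le, Real.inv_rpow two_pos.le,
        Real.rpow_neg two_pos.le]

variable {n : ℕ}

/-- The weighted mean of `g` over the ball with centre `z` and half the radius of the largest ball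
around `z` inside the unit ball. -/
noncomputable def localMean (β : ℝ) (g : Rn n → ℝ≥0∞) (z : Rn n) : ℝ≥0∞ :=
  ENNReal.ofReal ((1 - ‖z‖) ^ (β - 1 - n)) * ∫⁻ w in ball z ((1 - ‖z‖) / 2), g w

theorem measurable_localMean (β : ℝ) {g : Rn n → ℝ≥0∞} (hg : Measurable g) :
    Measurable (localMean β g) := by
  unfold localMean
  refine Measurable.mul (by fun_prop) ?_
  have hset : MeasurableSet {p : Rn n × Rn n | dist p.2 p.1 < (1 - ‖p.1‖) / 2} :=
    (isOpen_lt (by fun_prop) (by fun_prop)).measurableSet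
  have := ((hg.comp measurable_snd).indicator hset).lintegral_prod_right' (ν := volume)
  convert! this using 2 with z
  rw [← lintegral_indicator measurableSet_ball]
  rfl

/-- If `w` lies in the ball attached to `z`, then `1 - ‖z‖` and `1 - ‖w‖` agree up to a factor `2`
and `z ∈ ball w (1 - ‖w‖)`. After Tonelli, the volume of the latter ball cancels the `-n` in the
exponent of the local mean. -/
theorem exists_lintegral_localMean_le (n : ℕ) (β : ℝ) :
    ∃ C : ℝ≥0, ∀ g : Rn n → ℝ≥0∞, Measurable g →
      ∫⁻ z in ball (0 : Rn n) 1, localMean β g z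
        ≤ C * ∫⁻ w in ball (0 : Rn n) 1, g w * ENNReal.ofReal ((1 - ‖w‖) ^ (β - 1)) := by
  set γ : ℝ := β - 1 - n
  set V : ℝ≥0∞ := volume (ball (0 : Rn n) 1)
  have hV : V ≠ ∞ := measure_ball_lt_top.ne
  refine ⟨Real.toNNReal (2 ^ |γ|) * V.toNNReal, fun g hg => ?_⟩
  set T : Set (Rn n × Rn n) := {p | dist p.1 p.2 < 1 - ‖p.2‖}
  have hT : MeasurableSet T := (isOpen_lt (by fun_prop) (by fun_prop)).measurableSet
  set k : Rn n → ℝ≥0∞ := fun w => ENNReal.ofReal (2 ^ |γ| * (1 - ‖w‖) ^ γ) * g w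
  have hk : Measurable k := Measurable.mul (by fun_prop) hg
  calc ∫⁻ z in ball (0 : Rn n) 1, localMean β g z
      ≤ ∫⁻ z in ball (0 : Rn n) 1, ∫⁻ w, T.indicator (fun p => k p.2) (z, w) := by
        refine setLIntegral_mono' measurableSet_ball fun z hz => ?_
        have hz' : ‖z‖ < 1 := by simpa using hz
        rw [localMean, ← lintegral_const_mul _ hg, ← lintegral_indicator measurableSet_ball]
        refine lintegral_mono fun w => ?_
        by_cases hw : w ∈ ball z ((1 - ‖z‖) / 2)
        · have h1 : dist w z < (1 - ‖z‖) / 2 := hw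
          have h2 : ‖w‖ ≤ ‖z‖ + dist w z := by
            rw [dist_eq_norm]; exact norm_le_norm_add_norm_sub' w z
          have h3 : ‖z‖ ≤ ‖w‖ + dist w z := by
            rw [dist_comm, dist_eq_norm]; exact norm_le_norm_add_norm_sub' z w
          have hmem : (z, w) ∈ T := by
            change dist z w < 1 - ‖w‖
            rw [dist_comm]; linarith
          rw [Set.indicator_of_mem hw, Set.indicator_of_mem hmem]
          simp only [k]
          gcongr
          exact rpow_le_two_rpow_abs_mul γ (by linarith) (by linarith) (by linarith)
            (by linarith)
        · rw [Set.indicator_of_notMem hw]; exact zero_le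
    -- Nothing is lost: `T` already forces both points into the unit ball.
    _ ≤ ∫⁻ z, ∫⁻ w, T.indicator (fun p => k p.2) (z, w) := setLIntegral_le_lintegral _ _
    _ = ∫⁻ w, ∫⁻ z, T.indicator (fun p => k p.2) (z, w) :=
        lintegral_lintegral_swap ((hk.comp measurable_snd).indicator hT).aemeasurable
    _ = ∫⁻ w, k w * volume (ball w (1 - ‖w‖)) := by
        refine lintegral_congr fun w => ?_
        rw [← setLIntegral_const, ← lintegral_indicator measurableSet_ball]
        rfl
    _ = ∫⁻ w, (ball (0 : Rn n) 1).indicator (fun w => ENNReal.ofReal (2 ^ |γ|) * V *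
          (g w * ENNReal.ofReal ((1 - ‖w‖) ^ (β - 1)))) w := by
        refine lintegral_congr fun w => ?_
        by_cases hw : w ∈ ball (0 : Rn n) 1
        · have hw' : 0 < 1 - ‖w‖ := by simpa using hw
          rw [Set.indicator_of_mem hw, Measure.addHaar_ball_of_pos _ _ hw', finrank_euclideanSpace,
            Fintype.card_fin]
          have : (1 - ‖w‖) ^ (β - 1) = (1 - ‖w‖) ^ γ * (1 - ‖w‖) ^ n := by
            rw [← Real.rpow_natCast, ← Real.rpow_add hw']; simp [γ]
          simp only [k]
          rw [this, ENNReal.ofReal_mul (by positivity), ENNReal.ofReal_mul (by positivity)]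
          ring
        · have hw' : 1 - ‖w‖ ≤ 0 := by simpa using hw
          rw [Set.indicator_of_notMem hw, ball_eq_empty.2 hw', measure_empty, mul_zero]
    _ = _ := by
        rw [lintegral_indicator measurableSet_ball, lintegral_const_mul' _ _ (by finiteness),
          ENNReal.coe_mul, ENNReal.coe_toNNReal hV]
        rfl

/-- The integral of `localMean` along the radius in the direction `x'`. -/
noncomputable def radialIntegral (β : ℝ) (g : Rn n → ℝ≥0∞) (x' : S n) : ℝ≥0∞ :=
  ∫⁻ s in Set.Ioo (0 : ℝ) 1, localMean β g (s • (x' : Rn n)) * ENNReal.ofReal (s ^ (n - 1))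

/-- With `a = 1 - r`, the ball of radius `a / 8` at `r x'` lies in the ball attached to `s x'` for
every `s` in an interval of length `a / 16`. Integrating the resulting bound over `s` replaces a
supremum over `r` by an integral. -/
theorem exists_mul_ofReal_rpow_le_radialIntegral (n : ℕ) (β : ℝ) (C₀ : ℝ≥0) :
    ∃ C : ℝ≥0, ∀ g : Rn n → ℝ≥0∞,
      (∀ (z : Rn n) (R : ℝ), 0 < R → ‖z‖ + R < 1 →
        g z * ENNReal.ofReal (R ^ n) ≤ C₀ * ∫⁻ w in ball z R, g w) →
      ∀ (x' : S n), ∀ r ∈ Set.Ioo (0 : ℝ) 1,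
        g (r • (x' : Rn n)) * ENNReal.ofReal ((1 - r) ^ β) ≤ C * radialIntegral β g x' := by
  set γ : ℝ := β - 1 - n
  -- The factors pay for `1 - s` against `a`, for the radius `a / 8`, and for `s ≥ 1 / 16`. This
  -- last bound is why the interval of `s` starts beyond `r`: the weight `s ^ (n - 1)` stays away
  -- from zero even for small `r`.
  set K : ℝ := 2 ^ |γ| * 8 ^ n * 16 ^ (n - 1)
  have hK : 0 < K := by positivity
  refine ⟨16 * (Real.toNNReal K * C₀), fun g hg x' r hr => ?_⟩
  set a : ℝ := 1 - r
  have ha : 0 < a := by simp only [a]; linarith [hr.2]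
  have hra : r = 1 - a := by simp only [a]; ring
  have ha1 : a < 1 := by simp only [a]; linarith [hr.1]
  have hx' : ‖(x' : Rn n)‖ = 1 := norm_eq_of_mem_sphere x'
  have hpt : ∀ s ∈ Set.Icc (r + a / 16) (r + a / 8),
      g (r • (x' : Rn n)) * ENNReal.ofReal (a ^ (β - 1)) ≤ ↑(Real.toNNReal K * C₀) *
        (localMean β g (s • (x' : Rn n)) * ENNReal.ofReal (s ^ (n - 1))) := by
    intro s hs
    have hs0 : 1 / 16 ≤ s := by linarith [hs.1]
    have hs1 : s < 1 := by linarith [hs.2]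
    have hnr : ‖r • (x' : Rn n)‖ = r := by
      rw [norm_smul, hx', mul_one, Real.norm_of_nonneg hr.1.le]
    have hns : ‖s • (x' : Rn n)‖ = s := by
      rw [norm_smul, hx', mul_one, Real.norm_of_nonneg (by linarith)]
    have hsub : ball (r • (x' : Rn n)) (a / 8) ⊆ ball (s • (x' : Rn n)) ((1 - s) / 2) := by
      refine ball_subset_ball' ?_
      rw [dist_eq_norm, ← sub_smul, norm_smul, hx', mul_one, Real.norm_eq_abs,
        abs_of_nonpos (by linarith [hs.1])]
      linarith [hs.2]
    have h1 := (hg (r • (x' : Rn n)) (a / 8) (by positivity) (by rw [hnr]; linarith)).trans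
      (mul_le_mul_right (lintegral_mono_set hsub) _)
    have hpow : a ^ (β - 1) ≤ K * ((1 - s) ^ γ * (a / 8) ^ n * s ^ (n - 1)) := by
      have e1 : a ^ (β - 1) = a ^ γ * a ^ n := by
        rw [← Real.rpow_natCast, ← Real.rpow_add ha]; simp [γ]
      have e2 : a ^ γ ≤ 2 ^ |γ| * (1 - s) ^ γ :=
        rpow_le_two_rpow_abs_mul γ ha (by linarith) (by linarith [hs.2]) (by linarith [hs.1])
      have e3 : 1 ≤ 16 ^ (n - 1) * s ^ (n - 1) := by
        rw [← mul_pow]; exact one_le_pow₀ (by linarith)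
      have e4 : 0 ≤ (1 - s) ^ γ := Real.rpow_nonneg (by linarith) _
      calc a ^ (β - 1) = a ^ γ * a ^ n * 1 := by rw [e1, mul_one]
        _ ≤ (2 ^ |γ| * (1 - s) ^ γ) * a ^ n * (16 ^ (n - 1) * s ^ (n - 1)) := by gcongr
        _ = _ := by
          simp only [K, div_pow]
          field_simp
    calc g (r • (x' : Rn n)) * ENNReal.ofReal (a ^ (β - 1))
        ≤ g (r • (x' : Rn n)) *
          ENNReal.ofReal (K * ((1 - s) ^ γ * (a / 8) ^ n * s ^ (n - 1))) := by gcongr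
      _ = ENNReal.ofReal K * ENNReal.ofReal ((1 - s) ^ γ) * ENNReal.ofReal (s ^ (n - 1)) *
          (g (r • (x' : Rn n)) * ENNReal.ofReal ((a / 8) ^ n)) := by
          have e4 : 0 ≤ (1 - s) ^ γ := Real.rpow_nonneg (by linarith) _
          rw [ENNReal.ofReal_mul hK.le, ENNReal.ofReal_mul (q := s ^ (n - 1)) (by positivity),
            ENNReal.ofReal_mul e4]
          ring
      _ ≤ ENNReal.ofReal K * ENNReal.ofReal ((1 - s) ^ γ) * ENNReal.ofReal (s ^ (n - 1)) *
          (C₀ * ∫⁻ w in ball (s • (x' : Rn n)) ((1 - s) / 2), g w) := by gcongr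
      _ = _ := by
          rw [localMean, hns, ENNReal.coe_mul, ENNReal.ofReal]
          ring
  have hsubset : Set.Icc (r + a / 16) (r + a / 8) ⊆ Set.Ioo (0 : ℝ) 1 := fun s hs =>
    ⟨by linarith [hs.1, hr.1], by linarith [hs.2]⟩
  have hint : g (r • (x' : Rn n)) * ENNReal.ofReal (a ^ (β - 1)) * ENNReal.ofReal (a / 16)
      ≤ ↑(Real.toNNReal K * C₀) * radialIntegral β g x' := by
    calc g (r • (x' : Rn n)) * ENNReal.ofReal (a ^ (β - 1)) * ENNReal.ofReal (a / 16)
        = ∫⁻ _ in Set.Icc (r + a / 16) (r + a / 8),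
            g (r • (x' : Rn n)) * ENNReal.ofReal (a ^ (β - 1)) := by
          rw [setLIntegral_const, Real.volume_Icc]
          congr 2; ring
      _ ≤ ∫⁻ s in Set.Icc (r + a / 16) (r + a / 8), ↑(Real.toNNReal K * C₀) *
            (localMean β g (s • (x' : Rn n)) * ENNReal.ofReal (s ^ (n - 1))) :=
          setLIntegral_mono' measurableSet_Icc hpt
      _ = ↑(Real.toNNReal K * C₀) * ∫⁻ s in Set.Icc (r + a / 16) (r + a / 8),
            (localMean β g (s • (x' : Rn n)) * ENNReal.ofReal (s ^ (n - 1))) :=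
          lintegral_const_mul' _ _ ENNReal.coe_ne_top
      _ ≤ _ := by
          gcongr
          exact lintegral_mono_set hsubset
  calc g (r • (x' : Rn n)) * ENNReal.ofReal (a ^ β)
      = 16 * (g (r • (x' : Rn n)) * ENNReal.ofReal (a ^ (β - 1)) * ENNReal.ofReal (a / 16)) := by
        have : a ^ β = 16 * (a ^ (β - 1) * (a / 16)) := by
          rw [Real.rpow_sub_one ha.ne']; field_simp
        rw [this, ENNReal.ofReal_mul (by norm_num), ENNReal.ofReal_mul (by positivity)]
        norm_num
        ring
    _ ≤ 16 * (↑(Real.toNNReal K * C₀) * radialIntegral β g x') := by gcongr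
    _ = _ := by rw [ENNReal.coe_mul 16, ← mul_assoc]; rfl

/-! ### The one-dimensional estimate and its integration over the sphere -/

/-- The radial estimate behind the embedding. -/
theorem rpow_lintegral_le_add {β s : ℝ} (hs : 1 ≤ s) {h : ℝ → ℝ≥0∞} (hh : Measurable h)
    {M : ℝ≥0∞} (hM : ∀ r ∈ Set.Ioo (0 : ℝ) 1, h r * ENNReal.ofReal ((1 - r) ^ β) ≤ M) (m : ℕ) :
    (∫⁻ r in Set.Ioo (0 : ℝ) 1, h r ^ s * ENNReal.ofReal ((1 - r) ^ (β * s - 1))) ^ (1 / s)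
      ≤ 3 * M + 2 ^ m *
        ∫⁻ r in Set.Ioo (0 : ℝ) 1, h r * ENNReal.ofReal ((1 - r) ^ (β - 1) * r ^ m) := by
  set D := ∫⁻ r in Set.Ioo (0 : ℝ) 1, h r * ENNReal.ofReal ((1 - r) ^ (β - 1))
  set B := ∫⁻ r in Set.Ioo (0 : ℝ) 1, h r * ENNReal.ofReal ((1 - r) ^ (β - 1) * r ^ m)
  have hX : ∫⁻ r in Set.Ioo (0 : ℝ) 1, h r ^ s * ENNReal.ofReal ((1 - r) ^ (β * s - 1))
      ≤ M ^ (s - 1) * D := by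
    have hm : Measurable fun r => h r * ENNReal.ofReal ((1 - r) ^ (β - 1)) := by fun_prop
    rw [← lintegral_const_mul _ hm]
    refine setLIntegral_mono' measurableSet_Ioo fun r hr => ?_
    have ha : 0 < 1 - r := by linarith [hr.2]
    calc h r ^ s * ENNReal.ofReal ((1 - r) ^ (β * s - 1))
        = (h r * ENNReal.ofReal ((1 - r) ^ β)) ^ (s - 1) *
          (h r * ENNReal.ofReal ((1 - r) ^ (β - 1))) := by
          rw [ENNReal.mul_rpow_of_nonneg _ _ (by linarith),
            ENNReal.ofReal_rpow_of_nonneg (by positivity) (by linarith), ← Real.rpow_mul ha.le,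
            mul_mul_mul_comm, ← ENNReal.ofReal_mul (by positivity), ← Real.rpow_add ha]
          congr 1
          · conv_rhs => rw [← ENNReal.rpow_one (h r), ← ENNReal.rpow_mul, one_mul]
            rw [← ENNReal.rpow_add_of_nonneg _ _ (by linarith) zero_le_one, sub_add_cancel]
          · congr 2; ring
      _ ≤ _ := by gcongr; exact hM r hr
  -- The factor `r ^ m` degenerates at the origin, so `r ≤ 1/2` is controlled by `M`, using `1 ≤ 2
  -- (1 - r)`; for `r ≥ 1/2` one has `1 ≤ 2^m r^m`.
  have hD : D ≤ 2 * M + 2 ^ m * B := by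
    calc D ≤ ∫⁻ r in Set.Ioo (0 : ℝ) 1, (2 * M + 2 ^ m *
          (h r * ENNReal.ofReal ((1 - r) ^ (β - 1) * r ^ m))) := by
          refine setLIntegral_mono' measurableSet_Ioo fun r hr => ?_
          have ha : 0 < 1 - r := by linarith [hr.2]
          rcases le_total r (1 / 2) with h2 | h2
          · refine le_add_right ?_
            calc h r * ENNReal.ofReal ((1 - r) ^ (β - 1))
                ≤ h r * ENNReal.ofReal (2 * (1 - r) ^ β) := by
                  gcongr
                  rw [Real.rpow_sub_one ha.ne', div_le_iff₀ ha]
                  nlinarith [Real.rpow_pos_of_pos ha β]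
              _ = 2 * (h r * ENNReal.ofReal ((1 - r) ^ β)) := by
                  rw [ENNReal.ofReal_mul zero_le_two]; norm_num; ring
              _ ≤ 2 * M := by gcongr; exact hM r hr
          · refine le_add_left ?_
            calc h r * ENNReal.ofReal ((1 - r) ^ (β - 1))
                ≤ h r * ENNReal.ofReal (2 ^ m * ((1 - r) ^ (β - 1) * r ^ m)) := by
                  gcongr
                  have : 1 ≤ 2 ^ m * r ^ m := by
                    rw [← mul_pow]; exact one_le_pow₀ (by linarith)
                  nlinarith [Real.rpow_pos_of_pos ha (β - 1)]
              _ = _ := by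
                  rw [ENNReal.ofReal_mul (by positivity), ENNReal.ofReal_pow zero_le_two,
                    ENNReal.ofReal_ofNat]
                  ring
      _ = 2 * M + 2 ^ m * B := by
          rw [lintegral_add_left measurable_const, setLIntegral_const, Real.volume_Ioo,
            lintegral_const_mul' _ _ (by finiteness)]
          simp [B]
  calc _ ≤ (M ^ (s - 1) * D) ^ (1 / s) := by gcongr
    _ ≤ ((M + D) ^ (s - 1) * (M + D) ^ (1 : ℝ)) ^ (1 / s) := by
        rw [ENNReal.rpow_one]
        gcongr
        · exact le_self_add
        · exact le_add_self
    _ = M + D := by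
        rw [← ENNReal.rpow_add_of_nonneg _ _ (by linarith) zero_le_one, sub_add_cancel,
          ← ENNReal.rpow_mul, mul_one_div_cancel (by linarith), ENNReal.rpow_one]
    _ ≤ M + (2 * M + 2 ^ m * B) := by gcongr
    _ = 3 * M + 2 ^ m * B := by ring

theorem lintegral_toSphere_Ioo (hn : 1 ≤ n) {G : Rn n → ℝ≥0∞} (hG : Measurable G) :
    ∫⁻ x' : S n, (∫⁻ r in Set.Ioo (0 : ℝ) 1, G (r • (x' : Rn n)) *
      ENNReal.ofReal (r ^ (n - 1))) ∂(volume : Measure (Rn n)).toSphere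
      = ∫⁻ z in ball (0 : Rn n) 1, G z := by
  have : Nonempty (Fin n) := ⟨⟨0, hn⟩⟩
  simpa using lintegral_toSphere_lintegral_Ioo (volume : Measure (Rn n)) hG

/-- The embedding estimate for functions that are dominated by their means over balls. -/
theorem exists_lintegral_toSphere_rpow_le (hn : 1 ≤ n) (β : ℝ) {s : ℝ} (hs : 1 ≤ s) (C₀ : ℝ≥0) :
    ∃ C : ℝ≥0, ∀ g : Rn n → ℝ≥0∞, Measurable g →
      (∀ (z : Rn n) (R : ℝ), 0 < R → ‖z‖ + R < 1 →
        g z * ENNReal.ofReal (R ^ n) ≤ C₀ * ∫⁻ w in ball z R, g w) →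
      ∫⁻ x' : S n, (∫⁻ r in Set.Ioo (0 : ℝ) 1, g (r • (x' : Rn n)) ^ s *
          ENNReal.ofReal ((1 - r) ^ (β * s - 1))) ^ (1 / s) ∂(volume : Measure (Rn n)).toSphere
        ≤ C * ∫⁻ x' : S n, (∫⁻ r in Set.Ioo (0 : ℝ) 1, g (r • (x' : Rn n)) *
          ENNReal.ofReal ((1 - r) ^ (β - 1) * r ^ (n - 1))) ∂(volume : Measure (Rn n)).toSphere := by
  obtain ⟨C₁, hC₁⟩ := exists_lintegral_localMean_le n β
  obtain ⟨C₂, hC₂⟩ := exists_mul_ofReal_rpow_le_radialIntegral n β C₀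
  refine ⟨3 * C₂ * C₁ + 2 ^ (n - 1), fun g hg hmean => ?_⟩
  set B : S n → ℝ≥0∞ := fun x' => ∫⁻ r in Set.Ioo (0 : ℝ) 1, g (r • (x' : Rn n)) *
          ENNReal.ofReal ((1 - r) ^ (β - 1) * r ^ (n - 1))
  have hB : ∫⁻ x', B x' ∂(volume : Measure (Rn n)).toSphere
      = ∫⁻ w in ball (0 : Rn n) 1, g w * ENNReal.ofReal ((1 - ‖w‖) ^ (β - 1)) := by
    have hm : Measurable fun w => g w * ENNReal.ofReal ((1 - ‖w‖) ^ (β - 1)) := by fun_prop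
    rw [← lintegral_toSphere_Ioo hn hm]
    refine lintegral_congr fun x' => setLIntegral_congr_fun measurableSet_Ioo fun r hr => ?_
    have h1 : 0 < 1 - r := by linarith [hr.2]
    simp only [norm_smul, norm_eq_of_mem_sphere, mul_one, Real.norm_of_nonneg hr.1.le]
    rw [ENNReal.ofReal_mul (by positivity), mul_assoc]
  have hA : ∫⁻ x', radialIntegral β g x' ∂(volume : Measure (Rn n)).toSphere
      = ∫⁻ z in ball (0 : Rn n) 1, localMean β g z :=
    lintegral_toSphere_Ioo hn (measurable_localMean β hg)
  -- Splitting the integral of a sum needs only one measurable summand, so `radialIntegral` requires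
  -- no such check.
  have hBm : Measurable B := by
    refine Measurable.lintegral_prod_right' (f := fun p : S n × ℝ => g (p.2 • (p.1 : Rn n)) *
          ENNReal.ofReal ((1 - p.2) ^ (β - 1) * p.2 ^ (n - 1))) ?_
    exact (hg.comp (by fun_prop)).mul (by fun_prop)
  calc _ ≤ ∫⁻ x' : S n, (3 * (C₂ * radialIntegral β g x') + 2 ^ (n - 1) * B x')
          ∂(volume : Measure (Rn n)).toSphere := by
        refine lintegral_mono fun x' => ?_
        exact rpow_lintegral_le_add hs (h := fun r => g (r • (x' : Rn n)))
          (hg.comp (by fun_prop)) (hC₂ g hmean x') (n - 1)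
    _ = 3 * (C₂ * ∫⁻ x', radialIntegral β g x' ∂(volume : Measure (Rn n)).toSphere) +
          2 ^ (n - 1) * ∫⁻ x', B x' ∂(volume : Measure (Rn n)).toSphere := by
        rw [lintegral_add_right _ (hBm.const_mul _), lintegral_const_mul' _ _ (by finiteness),
          lintegral_const_mul' _ _ (by finiteness), lintegral_const_mul' _ _ (by finiteness)]
    _ ≤ 3 * (C₂ * (C₁ * ∫⁻ x', B x' ∂(volume : Measure (Rn n)).toSphere)) +
          2 ^ (n - 1) * ∫⁻ x', B x' ∂(volume : Measure (Rn n)).toSphere := by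
        rw [hA, hB]
        gcongr
        exact hC₁ g hg
    _ = _ := by push_cast; ring

/-! ### Application to harmonic functions -/

theorem isFiniteMeasure_surf (n : ℕ) : IsFiniteMeasure (surf n) :=
  Measure.smul_finite _ (ENNReal.inv_ne_top.2 (measure_ball_pos _ _ one_pos).ne')

/-- The function `|f| ^ p` on the unit ball, extended by zero. -/
noncomputable def powOnBall (p : ℝ) (f : Rn n → ℂ) : Rn n → ℝ≥0∞ :=
  (ball (0 : Rn n) 1).indicator fun z => ‖f z‖ₑ ^ p

/-- Outside the ball `f` is arbitrary; measurability comes from continuity inside and the cutoff. -/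
theorem measurable_powOnBall (p : ℝ) {f : Rn n → ℂ} (hf : f ∈ harmonicSpace n) :
    Measurable (powOnBall p f) := by
  have hf' : HarmonicOnNhd f (ball (0 : Rn n) 1) := hf
  have h : Measurable ((ball (0 : Rn n) 1).indicator f) := by
    classical
    rw [← Set.piecewise_eq_indicator]
    exact hf'.continuousOn.measurable_piecewise continuousOn_const measurableSet_ball
  have h2 : powOnBall p f = (ball (0 : Rn n) 1).indicator
      fun z => ‖(ball (0 : Rn n) 1).indicator f z‖ₑ ^ p := by
    ext z
    by_cases hz : z ∈ ball (0 : Rn n) 1 <;>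
      simp only [powOnBall, Set.indicator, hz, if_true, if_false]
  rw [h2]
  exact (h.enorm.pow_const p).indicator measurableSet_ball

theorem powOnBall_smul (p : ℝ) (f : Rn n → ℂ) (x' : S n) {r : ℝ} (hr : r ∈ Set.Ioo (0 : ℝ) 1) :
    powOnBall p f (r • (x' : Rn n)) = ‖f (r • (x' : Rn n))‖ₑ ^ p := by
  refine Set.indicator_of_mem ?_ _
  simpa [norm_smul, abs_of_pos hr.1] using hr.2

theorem exists_powOnBall_mul_le (n : ℕ) {p : ℝ} (hp : 0 < p) (hp1 : p ≤ 1) :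
    ∃ C : ℝ≥0, ∀ f ∈ harmonicSpace n, ∀ (z : Rn n) (R : ℝ), 0 < R → ‖z‖ + R < 1 →
      powOnBall p f z * ENNReal.ofReal (R ^ n) ≤ C * ∫⁻ w in ball z R, powOnBall p f w := by
  obtain ⟨C, hC⟩ := exists_enorm_rpow_mul_ofReal_pow_le (E := Rn n) hp hp1
  refine ⟨C, fun f hf z R hR hzR => ?_⟩
  have hf' : HarmonicOnNhd f (ball (0 : Rn n) 1) := hf
  have hsub : ball z (1 - ‖z‖) ⊆ ball (0 : Rn n) 1 := ball_subset_ball' (by simp)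
  have hsub' : ball z R ⊆ ball (0 : Rn n) 1 := (ball_subset_ball (by linarith)).trans hsub
  have h := hC f z R (1 - ‖z‖) hR (by linarith) (hf'.mono hsub)
  rw [finrank_euclideanSpace, Fintype.card_fin] at h
  rw [powOnBall, Set.indicator_of_mem (hsub' (mem_ball_self hR)),
    setLIntegral_congr_fun measurableSet_ball fun w hw => Set.indicator_of_mem (hsub' hw) _]
  exact h

theorem integralMean_rpow {p : ℝ} (hp : 0 < p) (f : Rn n → ℂ) (r : ℝ) :
    integralMean (ENNReal.ofReal p) f r ^ p
      = ∫⁻ x' : S n, ‖f (r • (x' : Rn n))‖ₑ ^ p ∂(surf n) := by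
  rw [integralMean, eLpNorm_eq_lintegral_rpow_enorm_toReal (ENNReal.ofReal_pos.2 hp).ne'
    ENNReal.ofReal_ne_top, ENNReal.toReal_ofReal hp.le, ← ENNReal.rpow_mul,
    one_div_mul_cancel hp.ne', ENNReal.rpow_one]

/-- This exposes the form with `β = αp` and `s = q/p`, since `αq = βs`. -/
theorem normF_rpow {p : ℝ} (hp : 0 < p) (q α : ℝ) (f : Rn n → ℂ) :
    normF q p α f ^ p = ∫⁻ x' : S n, (∫⁻ r in Set.Ioo (0 : ℝ) 1,
      powOnBall p f (r • (x' : Rn n)) ^ (q / p) *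
        ENNReal.ofReal ((1 - r) ^ (α * p * (q / p) - 1))) ^ (1 / (q / p)) ∂(surf n) := by
  rw [normF, ← ENNReal.rpow_mul, one_div_mul_cancel hp.ne', ENNReal.rpow_one, one_div_div]
  refine lintegral_congr fun x' => ?_
  congr 1
  refine setLIntegral_congr_fun measurableSet_Ioo fun r hr => ?_
  rw [powOnBall_smul p f x' hr, ← ENNReal.rpow_mul, mul_assoc, mul_div_cancel₀ _ hp.ne']

/-- Tonelli, together with `1 - r ≤ 1 - r² ≤ 2 (1 - r)`; the absolute value in the constant covers
both signs of `αp - 1`. -/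
theorem lintegral_powOnBall_le_normB_rpow {p : ℝ} (hp : 0 < p) (α : ℝ) {f : Rn n → ℂ}
    (hf : f ∈ harmonicSpace n) :
    ∫⁻ x' : S n, (∫⁻ r in Set.Ioo (0 : ℝ) 1, powOnBall p f (r • (x' : Rn n)) *
        ENNReal.ofReal ((1 - r) ^ (α * p - 1) * r ^ (n - 1))) ∂(surf n)
      ≤ ENNReal.ofReal (2 ^ |α * p - 1|) * normB p (ENNReal.ofReal p) α f ^ p := by
  have := isFiniteMeasure_surf n
  have hg := measurable_powOnBall p hf
  rw [normB, ← ENNReal.rpow_mul, one_div_mul_cancel hp.ne', ENNReal.rpow_one,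
    lintegral_lintegral_swap (by fun_prop), ← lintegral_const_mul' _ _ ENNReal.ofReal_ne_top]
  refine setLIntegral_mono' measurableSet_Ioo fun r hr => ?_
  have ha : 0 < 1 - r := by linarith [hr.2]
  have hr0 := hr.1
  rw [lintegral_mul_const' _ _ ENNReal.ofReal_ne_top, integralMean_rpow hp,
    lintegral_congr fun x' => powOnBall_smul p f x' hr, mul_left_comm,
    ← ENNReal.ofReal_mul (by positivity), ← mul_assoc]
  gcongr
  exact rpow_le_two_rpow_abs_mul _ ha (by nlinarith) (by nlinarith) (by nlinarith)

theorem exists_normF_le_mul_normB (hn : 1 ≤ n) {p q α : ℝ} (hp : 0 < p) (hp1 : p ≤ 1)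
    (hpq : p ≤ q) :
    ∃ C : ℝ≥0, 0 < C ∧ ∀ f ∈ harmonicSpace n,
      normF q p α f ≤ C * normB p (ENNReal.ofReal p) α f := by
  obtain ⟨C₀, hC₀⟩ := exists_powOnBall_mul_le n hp hp1
  obtain ⟨C, hC⟩ := exists_lintegral_toSphere_rpow_le hn (α * p) ((one_le_div hp).2 hpq) C₀
  -- The summand `1` keeps the constant positive even if `C = 0`.
  set K : ℝ≥0 := C * Real.toNNReal (2 ^ |α * p - 1|) + 1
  refine ⟨K ^ (1 / p), NNReal.rpow_pos (by positivity), fun f hf => ?_⟩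
  have hmain := hC (powOnBall p f) (measurable_powOnBall p hf) (hC₀ f hf)
  rw [← ENNReal.rpow_le_rpow_iff hp, ENNReal.mul_rpow_of_nonneg _ _ hp.le,
    ENNReal.coe_rpow_of_nonneg _ (by positivity), ← ENNReal.rpow_mul, one_div_mul_cancel hp.ne',
    ENNReal.rpow_one]
  calc normF q p α f ^ p
      ≤ C * ∫⁻ x' : S n, (∫⁻ r in Set.Ioo (0 : ℝ) 1, powOnBall p f (r • (x' : Rn n)) *
        ENNReal.ofReal ((1 - r) ^ (α * p - 1) * r ^ (n - 1))) ∂(surf n) := by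
        rw [normF_rpow hp, surf, lintegral_smul_measure, lintegral_smul_measure,
          smul_eq_mul, smul_eq_mul, mul_left_comm]
        gcongr
    _ ≤ C * (ENNReal.ofReal (2 ^ |α * p - 1|) * normB p (ENNReal.ofReal p) α f ^ p) := by
        gcongr
        exact lintegral_powOnBall_le_normB_rpow hp α hf
    _ = ↑(C * Real.toNNReal (2 ^ |α * p - 1|)) * normB p (ENNReal.ofReal p) α f ^ p := by
        rw [ENNReal.coe_mul, mul_assoc]; rfl
    _ ≤ K * normB p (ENNReal.ofReal p) α f ^ p := by
        gcongr
        exact le_self_add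

end HarmonicBall

theorem mainTheorem12 (n : ℕ) (hn : 1 ≤ n) (p q α : ℝ) (hp : 0 < p) (hp1 : p ≤ 1) (hpq : p ≤ q)
    (hα : 0 < α) :
    HarmonicBall.spaceB n p (ENNReal.ofReal p) α ⊆ HarmonicBall.spaceF n q p α ∧
    ∃ C : ℝ≥0, 0 < C ∧ ∀ f ∈ HarmonicBall.harmonicSpace n,
      HarmonicBall.normF q p α f ≤ C * HarmonicBall.normB p (ENNReal.ofReal p) α f := by
  obtain ⟨C, hC0, hC⟩ := HarmonicBall.exists_normF_le_mul_normB (α := α) hn hp hp1 hpq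
  exact ⟨fun f hf => ⟨hf.1, (hC f hf.1).trans_lt (ENNReal.mul_lt_top ENNReal.coe_lt_top hf.2)⟩,
    C, hC0, hC⟩
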